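/- Let $G$ be a CHART group, i.e. a group with a compact Hausdorff topology such that every right shift $g\mapsto gh$ ($h\in G$) is continuous and such that the topological center $\Lambda(G)=\{g\in G : h\mapsto gh \text{ is continuous}\}$ is dense in $G$. Assume the continuum hypothesis $2^{\aleph_0}=\aleph_1$. If $G$ is sequentially compact (every sequence in $G$ has a convergent subsequence), then $G$ is metrizable, and hence $G$ is a topological group (multiplication and inversion are continuous). -/

import Mathlib

/-- The continuum hypothesis: `2 ^ ℵ₀ = ℵ₁`. -/
def ContinuumHypothesis : Prop :=
  Cardinal.continuum.{0} = Cardinal.aleph.{0} 1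

/-- A group with a topology is right topological if all right shifts `g ↦ g * h` are continuous. -/
structure IsRightTopologicalGroup (G : Type*) [Group G] [TopologicalSpace G] : Prop where
  continuous_rightShift : ∀ h : G, Continuous fun g : G => g * h

/-- The topological center `Λ(G)`: the set of all `g` whose left shift `h ↦ g * h` is continuous. -/
def topologicalCenter (G : Type*) [Group G] [TopologicalSpace G] : Set G :=
  {g : G | Continuous fun h : G => g * h}

/-- A right topological group is admissible if its topological center is dense. -/
structure IsAdmissibleRightTopologicalGroup (G : Type*) [Group G] [TopologicalSpace G] : Prop
    extends IsRightTopologicalGroup G where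
  dense_topologicalCenter : Dense (topologicalCenter G)

/-- A CHART group: a compact Hausdorff admissible right topological group. -/
structure IsCHARTGroup (G : Type*) [Group G] [TopologicalSpace G] : Prop
    extends IsAdmissibleRightTopologicalGroup G where
  compactSpace : CompactSpace G
  t2Space : T2Space G

open Set Filter Topology TopologicalSpace

/-! If no point had a countable `π`-network of closed `Gδ` sets, CH would list all `φ : ℕ → ℕ` with
countably many predecessors each. Shrinking closed `Gδ` sets `F n` along this list, one makes `F (φ
k)` fall infinitely often into each of two disjoint closed sets, for every injective `φ`. Points
chosen in the final intersections then have no convergent subsequence.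

So some `p` has such a network. In a CHART group this reaches every pair: the orbit map `g ↦ (g * x,
g * y)` has compact range, and if `(x, y)` lies in suitable countably many open sets, that range
contains `(p, p)`, whence `x = y`. The diagonal is thus `Gδ` and `G` is metrizable; Baire category
then gives joint continuity. -/

/-- A sequence of nonempty closed `Gδ` sets. -/
def IsClosedGδSeq {X : Type*} [TopologicalSpace X] (F : ℕ → Set X) : Prop :=
  ∀ n, IsClosed (F n) ∧ IsGδ (F n) ∧ (F n).Nonempty

/-- The sets `F n` form a `π`-network at `p`: every neighbourhood of `p` contains one of them. -/
def IsPiNetworkAt {X : Type*} [TopologicalSpace X] (F : ℕ → Set X) (p : X) : Prop :=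
  ∀ U ∈ 𝓝 p, ∃ n, F n ⊆ U

/-- An infinite set of natural numbers contains two disjoint infinite sets. -/
theorem Set.Infinite.exists_disjoint_infinite_subsets {α : Type*} {S : Set α} (hS : S.Infinite) :
    ∃ P ⊆ S, ∃ Q ⊆ S, P.Infinite ∧ Q.Infinite ∧ Disjoint P Q := by
  obtain ⟨P, Q, hu, hd, h⟩ := hS.exists_union_disjoint_cardinal_eq_of_infinite
  have hPQ : P.Infinite ↔ Q.Infinite := by
    rw [← infinite_coe_iff, ← infinite_coe_iff, Cardinal.infinite_iff, Cardinal.infinite_iff, h]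
  have hP : P.Infinite := by
    by_contra hP
    refine hS (hu ▸ (not_infinite.1 hP).union (not_infinite.1 fun hQ => hP (hPQ.2 hQ)))
  exact ⟨P, hu ▸ subset_union_left, Q, hu ▸ subset_union_right, hP, hPQ.1 hP, hd⟩

/-- If no point has a countable `π`-network of closed `Gδ` sets, then a sequence of nonempty closed
`Gδ` sets can be shrunk so that a given subsequence is split by two disjoint closed sets. -/
theorem IsClosedGδSeq.exists_splitting {X : Type*} [TopologicalSpace X] [CompactSpace X] [T2Space X]
    (hX : ∀ (p : X) (F : ℕ → Set X), IsClosedGδSeq F → ¬ IsPiNetworkAt F p)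
    {F : ℕ → Set X} (hF : IsClosedGδSeq F) {φ : ℕ → ℕ} (hφ : Function.Injective φ) :
    ∃ F' : ℕ → Set X, (∀ n, F' n ⊆ F n) ∧ IsClosedGδSeq F' ∧
      ∃ A B : Set X, IsClosed A ∧ IsClosed B ∧ Disjoint A B ∧
        (∃ᶠ k in atTop, F' (φ k) ⊆ A) ∧ ∃ᶠ k in atTop, F' (φ k) ⊆ B := by
  classical
  choose y hy using fun k => (hF (φ k)).2.2
  obtain ⟨p, hp⟩ := exists_clusterPt_of_compactSpace (map y atTop)
  have hnot := hX p (F ∘ φ) (fun k => hF (φ k))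
  simp only [IsPiNetworkAt, not_forall, not_exists] at hnot
  obtain ⟨U, hU, hFU⟩ := hnot
  obtain ⟨f, f0, f1, -⟩ := exists_continuous_zero_one_of_isClosed (isClosed_singleton (x := p))
    (isOpen_interior (s := U)).isClosed_compl
    (disjoint_singleton_left.2 fun h => h (mem_interior_iff_mem_nhds.2 hU))
  -- `A` is a neighbourhood of the cluster point `p`, so infinitely many `F (φ k)` meet it; `B`
  -- contains the complement of `U`, so all of them meet it.
  set A : Set X := f ⁻¹' Iic (1 / 3) with hA
  set B : Set X := f ⁻¹' Ici (1 / 2) with hB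
  have cA : IsClosed A := isClosed_Iic.preimage f.continuous
  have cB : IsClosed B := isClosed_Ici.preimage f.continuous
  have gA : IsGδ A := (isClosed_Iic.isGδ).preimage f.continuous
  have gB : IsGδ B := (isClosed_Ici.isGδ).preimage f.continuous
  have hAB : Disjoint A B := by
    refine disjoint_left.2 fun x hx hx' => ?_
    simp only [hA, hB, mem_preimage, mem_Iic, mem_Ici] at hx hx'
    linarith
  have hAp : A ∈ 𝓝 p := f.continuous.continuousAt.preimage_mem_nhds
    (Iic_mem_nhds (by rw [f0 (mem_singleton p)]; norm_num))
  have hS : {k | (F (φ k) ∩ A).Nonempty}.Infinite := by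
    rw [← Nat.frequently_atTop_iff_infinite]
    have : ∃ᶠ k in atTop, y k ∈ A := (mapClusterPt_iff_frequently.1 hp) A hAp
    exact this.mono fun k hk => ⟨y k, hy k, hk⟩
  have hFB : ∀ k, (F (φ k) ∩ B).Nonempty := fun k => by
    obtain ⟨x, hx, hxU⟩ := not_subset.1 (hFU k)
    refine ⟨x, hx, ?_⟩
    have : f x = 1 := f1 fun h => hxU (interior_subset h)
    simp only [hB, mem_preimage, mem_Ici, this]
    norm_num
  obtain ⟨P, hPS, Q, -, hP, hQ, hPQ⟩ := hS.exists_disjoint_infinite_subsets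
  have hQP : ∀ k ∈ Q, φ k ∉ φ '' P := fun k hk h =>
    disjoint_left.1 hPQ (hφ.mem_set_image.1 h) hk
  refine ⟨fun n => if n ∈ φ '' P then F n ∩ A else if n ∈ φ '' Q then F n ∩ B else F n,
    fun n => ?_, fun n => ?_, A, B, cA, cB, hAB, ?_, ?_⟩
  · dsimp only
    split_ifs
    exacts [inter_subset_left, inter_subset_left, Subset.rfl]
  · obtain ⟨hc, hg, hn⟩ := hF n
    dsimp only
    split_ifs with h1 h2
    · obtain ⟨k, hk, rfl⟩ := h1
      exact ⟨hc.inter cA, hg.inter gA, hPS hk⟩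
    · obtain ⟨k, hk, rfl⟩ := h2
      exact ⟨hc.inter cB, hg.inter gB, hFB k⟩
    · exact ⟨hc, hg, hn⟩
  · refine (Nat.frequently_atTop_iff_infinite.2 hP).mono fun k hk => ?_
    dsimp only
    rw [if_pos (mem_image_of_mem φ hk)]
    exact inter_subset_right
  · refine (Nat.frequently_atTop_iff_infinite.2 hQ).mono fun k hk => ?_
    dsimp only
    rw [if_neg (hQP k hk), if_pos (mem_image_of_mem φ hk)]
    exact inter_subset_right

/-- In a compact space, a decreasing family of nonempty closed sets indexed by a linear order has
nonempty intersection. -/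
theorem nonempty_iInter_of_antitone_closed {X ι : Type*} [TopologicalSpace X] [CompactSpace X]
    [Nonempty X] [LinearOrder ι] {T : ι → Set X} (hT : Antitone T)
    (hc : ∀ i, IsClosed (T i)) (hn : ∀ i, (T i).Nonempty) : (⋂ i, T i).Nonempty := by
  rcases isEmpty_or_nonempty ι with h | h
  · simp
  · exact IsCompact.nonempty_iInter_of_directed_nonempty_isCompact_isClosed T hT.directed_ge hn
      (fun i => (hc i).isCompact) hc

/-- Transfinite iteration of shrinking operations on sequences of nonempty closed `Gδ` sets, along a
well-order with countable initial segments. -/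
theorem exists_transfinite_shrinking {X ι : Type*} [TopologicalSpace X] [CompactSpace X]
    [Nonempty X] [LinearOrder ι] [WellFoundedLT ι] (hι : ∀ i : ι, (Iio i).Countable)
    (step : ι → (ℕ → Set X) → ℕ → Set X) (hsub : ∀ i F n, step i F n ⊆ F n)
    (hstep : ∀ i F, IsClosedGδSeq F → IsClosedGδSeq (step i F)) :
    ∃ T : ι → ℕ → Set X, (∀ n, (⋂ i, T i n).Nonempty) ∧
      ∀ i, ∃ F, IsClosedGδSeq F ∧ T i = step i F := by
  -- Stage `i` acts on the intersection of all earlier stages, which stays `Gδ` because `Iio i` is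
  -- countable.
  let T : ι → ℕ → Set X := (wellFounded_lt (α := ι)).fix
    fun i ih => step i fun n => ⋂ j : Iio i, ih j j.2 n
  have hT : ∀ i, T i = step i fun n => ⋂ j : Iio i, T j n := fun i =>
    (wellFounded_lt (α := ι)).fix_eq _ i
  have anti : ∀ n, Antitone fun i => T i n := fun n i j hij => by
    rcases hij.eq_or_lt with rfl | h
    · exact Subset.rfl
    · change T j n ⊆ T i n
      rw [hT j]
      exact (hsub _ _ _).trans (iInter_subset (fun k : Iio j => T k n) ⟨i, h⟩)
  have good : ∀ i, (∀ j < i, IsClosedGδSeq (T j)) →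
      IsClosedGδSeq fun n => ⋂ j : Iio i, T j n := fun i ih n => by
    have : Countable (Iio i) := (hι i).to_subtype
    refine ⟨isClosed_iInter fun j => (ih j j.2 n).1, .iInter fun j => (ih j j.2 n).2.1, ?_⟩
    exact nonempty_iInter_of_antitone_closed (T := fun j : Iio i => T j n)
      (fun a b hab => anti n hab) (fun j => (ih j j.2 n).1) fun j => (ih j j.2 n).2.2
  have goodT : ∀ i, IsClosedGδSeq (T i) := fun i => by
    induction i using WellFoundedLT.induction with
    | ind i ih =>
      rw [hT i]
      exact hstep i _ (good i ih)
  exact ⟨T, fun n => nonempty_iInter_of_antitone_closed (anti n) (fun i => (goodT i n).1)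
    fun i => (goodT i n).2.2, fun i => ⟨_, good i fun j _ => goodT j, hT i⟩⟩

/-- Under the continuum hypothesis, the sequences of natural numbers can be enumerated along a
well-order with countable initial segments. -/
theorem ContinuumHypothesis.exists_wellOrder (hCH : ContinuumHypothesis) :
    ∃ (ι : Type) (_ : LinearOrder ι) (_ : WellFoundedLT ι),
      (∀ i : ι, (Iio i).Countable) ∧ ∃ e : ι → ℕ → ℕ, Function.Surjective e := by
  refine ⟨(Cardinal.aleph 1).ord.ToType, inferInstance, inferInstance, fun i => ?_, ?_⟩
  · have h1 := Cardinal.mk_Iio_lt i (by rw [Cardinal.mk_ord_toType, Ordinal.type_toType])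
    rw [Cardinal.mk_ord_toType] at h1
    exact Cardinal.le_aleph0_iff_set_countable.1 (Cardinal.lt_aleph_one_iff.1 h1)
  · have h2 : Cardinal.mk (Cardinal.aleph 1).ord.ToType = Cardinal.mk (ℕ → ℕ) := by
      rw [Cardinal.mk_ord_toType, ← hCH]
      simp
    obtain ⟨e⟩ := Cardinal.eq.1 h2
    exact ⟨e, e.surjective⟩

/-- Under the continuum hypothesis, a nonempty sequentially compact compact Hausdorff space has a
point with a countable `π`-network of closed `Gδ` sets. -/
theorem ContinuumHypothesis.exists_isPiNetworkAt (hCH : ContinuumHypothesis) {X : Type*}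
    [TopologicalSpace X] [CompactSpace X] [T2Space X] [Nonempty X] [SeqCompactSpace X] :
    ∃ (p : X) (F : ℕ → Set X), IsClosedGδSeq F ∧ IsPiNetworkAt F p := by
  by_contra hX
  push Not at hX
  have key : ∀ (φ : ℕ → ℕ) (F : ℕ → Set X), ∃ F' : ℕ → Set X, (∀ n, F' n ⊆ F n) ∧
      (IsClosedGδSeq F → IsClosedGδSeq F' ∧ (Function.Injective φ →
        ∃ A B : Set X, IsClosed A ∧ IsClosed B ∧ Disjoint A B ∧
          (∃ᶠ k in atTop, F' (φ k) ⊆ A) ∧ ∃ᶠ k in atTop, F' (φ k) ⊆ B)) := fun φ F => by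
    by_cases hF : IsClosedGδSeq F
    · by_cases hφ : Function.Injective φ
      · obtain ⟨F', h1, h2, h3⟩ := hF.exists_splitting hX hφ
        exact ⟨F', h1, fun _ => ⟨h2, fun _ => h3⟩⟩
      · exact ⟨F, fun _ => Subset.rfl, fun _ => ⟨hF, fun h => (hφ h).elim⟩⟩
    · exact ⟨F, fun _ => Subset.rfl, fun h => (hF h).elim⟩
  choose step hsub hstep using key
  obtain ⟨ι, l, w, hc, e, he⟩ := hCH.exists_wellOrder
  obtain ⟨T, hne, hT⟩ := exists_transfinite_shrinking hc (fun i => step (e i))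
    (fun i => hsub (e i)) fun i F hF => (hstep (e i) F hF).1
  choose x hx using hne
  obtain ⟨a, φ, hφ, hlim⟩ := SeqCompactSpace.tendsto_subseq x
  -- The extraction `φ` was treated at some stage `i`, which forces the limit into both `A` and `B`.
  obtain ⟨i, rfl⟩ := he φ
  obtain ⟨F, hF, hTF⟩ := hT i
  obtain ⟨A, B, cA, cB, hAB, hA, hB⟩ := (hstep (e i) F hF).2 hφ.injective
  rw [← hTF] at hA hB
  have hxT : ∀ k, x (e i k) ∈ T i (e i k) := fun k => mem_iInter.1 (hx (e i k)) i
  exact disjoint_left.1 hAB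
    (cA.mem_of_frequently_of_tendsto (hA.mono fun k hk => hk (hxT k)) hlim)
    (cB.mem_of_frequently_of_tendsto (hB.mono fun k hk => hk (hxT k)) hlim)

/-- A compact Hausdorff space with a `Gδ` diagonal is metrizable. -/
theorem metrizableSpace_of_isGδ_diagonal {X : Type*} [TopologicalSpace X] [CompactSpace X]
    [T2Space X] (h : IsGδ (diagonal X)) : MetrizableSpace X := by
  obtain ⟨f, hf, -⟩ := exists_continuous_one_zero_of_isCompact_of_isGδ
    (isClosed_diagonal (X := X)).isCompact h isClosed_empty (disjoint_empty _)
  have hf' : ∀ x y, f (x, y) = 1 ↔ x = y := fun x y => by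
    change (x, y) ∈ f ⁻¹' {1} ↔ _
    rw [← hf, mem_diagonal_iff]
  -- As `f` equals 1 exactly on the diagonal, evaluating at `y` separates points, so `X` embeds in
  -- `C(X, ℝ)`.
  have hinj : Function.Injective f.curry := fun x y hxy =>
    (hf' x y).1 ((congrArg (fun g : C(X, ℝ) => g y) hxy).trans ((hf' y y).2 rfl))
  exact (f.curry.continuous.isClosedEmbedding hinj).isEmbedding.metrizableSpace

section CHART

variable {G : Type*} [Group G] [TopologicalSpace G]

/-- In a CHART group, a countable `π`-network of closed `Gδ` sets at one point makes the diagonal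
a `Gδ` set. -/
theorem IsCHARTGroup.isGδ_diagonal (hG : IsCHARTGroup G) {p : G} {F : ℕ → Set G}
    (hF : IsClosedGδSeq F) (hp : IsPiNetworkAt F p) : IsGδ (diagonal G) := by
  have := hG.compactSpace
  have := hG.t2Space
  have hR := hG.continuous_rightShift
  have hf : ∀ n, ∃ f : C(G, ℝ), F n = f ⁻¹' {1} ∧ ∀ x, f x ≤ 1 := fun n => by
    obtain ⟨f, h1, -, -, h2⟩ := exists_continuous_one_zero_of_isCompact_of_isGδ
      (hF n).1.isCompact (hF n).2.1 isClosed_empty (disjoint_empty _)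
    exact ⟨f, h1, fun x => (h2 x).2⟩
  choose f hfF hf1 using hf
  -- Some `a` in the center brings both coordinates close to `F n = {f n = 1}`; taking `a` in the
  -- center makes the condition open in `z`.
  let O : ℕ × ℕ → Set (G × G) := fun i => ⋃ a ∈ topologicalCenter G,
    {z | 1 - 1 / ((i.2 : ℝ) + 1) < f i.1 (a * z.1) ∧ 1 - 1 / ((i.2 : ℝ) + 1) < f i.1 (a * z.2)}
  have hO : ∀ i, IsOpen (O i) := fun i => isOpen_biUnion fun a (ha : Continuous (a * ·)) =>
    (isOpen_lt continuous_const ((f i.1).continuous.comp (ha.comp continuous_fst))).inter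
      (isOpen_lt continuous_const ((f i.1).continuous.comp (ha.comp continuous_snd)))
  suffices h : diagonal G = ⋂ i, O i from h ▸ .iInter_of_isOpen hO
  refine Subset.antisymm (fun z hz => mem_iInter.2 fun i => ?_) fun z hz => ?_
  · obtain ⟨x, y⟩ := z
    obtain rfl : x = y := hz
    obtain ⟨g, hg⟩ := (hF i.1).2.2
    have hg1 : f i.1 g = 1 := by rw [hfF] at hg; exact hg
    obtain ⟨a, ha, haU⟩ := hG.dense_topologicalCenter.exists_mem_open
      (isOpen_lt continuous_const ((f i.1).continuous.comp (hR x)))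
      ⟨g * x⁻¹, show 1 - 1 / ((i.2 : ℝ) + 1) < f i.1 (g * x⁻¹ * x) by
        rw [inv_mul_cancel_right, hg1, sub_lt_self_iff]; positivity⟩
    exact mem_biUnion ha ⟨haU, haU⟩
  · obtain ⟨x, y⟩ := z
    have hxy : Continuous fun g : G => (g * x, g * y) := (hR x).prodMk (hR y)
    -- The maximum over the compact `G` turns approximate entry into `F n` into exact entry,
    -- possibly with `g` outside the center.
    have hn : ∀ n, ∃ g, g * x ∈ F n ∧ g * y ∈ F n := fun n => by
      obtain ⟨g, -, hg⟩ := isCompact_univ.exists_isMaxOn (univ_nonempty (α := G))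
        (((f n).continuous.comp (hR x)).min ((f n).continuous.comp (hR y))).continuousOn
      have hge : 1 ≤ min (f n (g * x)) (f n (g * y)) := by
        refine le_of_tendsto' (x := atTop) (f := fun k : ℕ => 1 - 1 / ((k : ℝ) + 1)) ?_ fun k => ?_
        · simpa using (tendsto_one_div_add_atTop_nhds_zero_nat (𝕜 := ℝ)).const_sub 1
        · obtain ⟨a, -, h1, h2⟩ := mem_iUnion₂.1 (mem_iInter.1 hz (n, k))
          exact (lt_min h1 h2).le.trans (hg (mem_univ a))
      rw [hfF]
      exact ⟨g, le_antisymm (hf1 n _) (hge.trans (min_le_left _ _)),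
        le_antisymm (hf1 n _) (hge.trans (min_le_right _ _))⟩
    have hmem : (p, p) ∈ closure (range fun g : G => (g * x, g * y)) := by
      refine mem_closure_iff_nhds.2 fun W hW => ?_
      obtain ⟨U, hU, V, hV, hUV⟩ := mem_nhds_prod_iff.1 hW
      obtain ⟨n, hFn⟩ := hp _ (inter_mem hU hV)
      obtain ⟨g, h1, h2⟩ := hn n
      exact ⟨_, hUV ⟨(hFn h1).1, (hFn h2).2⟩, g, rfl⟩
    rw [(isCompact_range hxy).isClosed.closure_eq] at hmem
    obtain ⟨g, hg⟩ := hmem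
    rw [Prod.mk.injEq] at hg
    exact mul_left_cancel (hg.1.trans hg.2.symm)

/-- Multiplication is jointly continuous in a metrizable CHART group. -/
theorem IsCHARTGroup.continuous_mul (hG : IsCHARTGroup G) [MetrizableSpace G] :
    Continuous fun z : G × G => z.1 * z.2 := by
  have := hG.compactSpace
  let := metrizableSpaceMetric G
  have hR := hG.continuous_rightShift
  let R : G → C(G, G) := fun y => ⟨(· * y), hR y⟩
  -- By density, the distance need only be tested at `a` in the center, where the condition on `y`
  -- is closed.
  have hball : ∀ (c : C(G, G)) (ε : ℝ), 0 ≤ ε → IsClosed {y | dist (R y) c ≤ ε} := fun c ε hε => by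
    have : {y | dist (R y) c ≤ ε} = ⋂ a ∈ topologicalCenter G, {y | dist (a * y) (c a) ≤ ε} := by
      ext y
      simp only [mem_ofPred_eq, mem_iInter, ContinuousMap.dist_le hε]
      refine ⟨fun h a _ => h a, fun h x => ?_⟩
      have hcl : IsClosed {x | dist (x * y) (c x) ≤ ε} :=
        isClosed_le ((hR y).dist c.continuous) continuous_const
      exact hcl.closure_subset_iff.2 h (hG.dense_topologicalCenter x)
    rw [this]
    exact isClosed_biInter fun a (ha : Continuous (a * ·)) =>
      isClosed_le (ha.dist continuous_const) continuous_const
  let c := denseSeq C(G, G)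
  let D : ℕ → Set G := fun k => ⋃ i, interior {y | dist (R y) (c i) ≤ 1 / ((k : ℝ) + 1)}
  have hD : Dense (⋂ k, D k) := by
    -- Since `C(G, G)` is separable, countably many of these closed sets cover `G`, and Baire yields
    -- a continuity point of `R`.
    refine dense_iInter_of_isOpen_nat (fun k => isOpen_iUnion fun i => isOpen_interior) fun k => ?_
    have hk : (0 : ℝ) < 1 / ((k : ℝ) + 1) := by positivity
    refine dense_iUnion_interior_of_closed (fun i => hball _ _ hk.le)
      (eq_univ_of_forall fun y => mem_iUnion.2 ?_)
    obtain ⟨i, hi⟩ := (denseRange_denseSeq C(G, G)).exists_dist_lt (R y) hk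
    exact ⟨i, hi.le⟩
  obtain ⟨y₀, hy₀⟩ := hD.nonempty
  have hcont₀ : ContinuousAt R y₀ := by
    refine Metric.tendsto_nhds.2 fun ε hε => ?_
    obtain ⟨k, hk⟩ := exists_nat_one_div_lt (half_pos hε)
    obtain ⟨i, hi⟩ := mem_iUnion.1 (mem_iInter.1 hy₀ k)
    have hi₀ : dist (R y₀) (c i) ≤ 1 / ((k : ℝ) + 1) :=
      interior_subset (s := {y | dist (R y) (c i) ≤ 1 / ((k : ℝ) + 1)}) hi
    filter_upwards [mem_interior_iff_mem_nhds.1 hi] with y hy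
    have hy' : dist (R y) (c i) ≤ 1 / ((k : ℝ) + 1) := hy
    linarith [dist_triangle_right (R y) (R y₀) (c i)]
  have hcont : Continuous R := continuous_iff_continuousAt.2 fun y => by
    -- Right translation carries continuity at `y₀` to any `y`.
    have heq : R = fun z => (R (y₀⁻¹ * y)).comp (R (z * (y₀⁻¹ * y)⁻¹)) := by
      ext z x
      change x * z = x * (z * (y₀⁻¹ * y)⁻¹) * (y₀⁻¹ * y)
      group
    rw [heq]
    have h1 : Tendsto (fun z => z * (y₀⁻¹ * y)⁻¹) (𝓝 y) (𝓝 y₀) := by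
      have := (hR (y₀⁻¹ * y)⁻¹).tendsto y
      simpa using this
    refine (ContinuousMap.continuous_postcomp (R (y₀⁻¹ * y))).continuousAt.comp
      (f := fun z => R (z * (y₀⁻¹ * y)⁻¹)) ?_
    have h2 : y * (y₀⁻¹ * y)⁻¹ = y₀ := by group
    change Tendsto _ _ (𝓝 (R (y * (y₀⁻¹ * y)⁻¹)))
    rw [h2]
    exact hcont₀.tendsto.comp h1
  exact (hcont.comp continuous_snd).eval continuous_fst

/-- A compact Hausdorff group with continuous multiplication is a topological group. -/
theorem isTopologicalGroup_of_compactSpace_of_continuousMul [CompactSpace G] [T2Space G]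
    [ContinuousMul G] : IsTopologicalGroup G where
  continuous_inv := by
    refine continuous_iff_isClosed.2 fun s hs => ?_
    -- The graph of inversion is closed, and projection along a compact factor is a closed map.
    have : (fun x : G => x⁻¹) ⁻¹' s = Prod.fst '' ({z : G × G | z.1 * z.2 = 1} ∩ Prod.snd ⁻¹' s) := by
      ext x
      constructor
      · exact fun hx => ⟨(x, x⁻¹), ⟨mul_inv_cancel x, hx⟩, rfl⟩
      · rintro ⟨⟨a, b⟩, ⟨hab, hb⟩, rfl⟩
        have : a⁻¹ = b := inv_eq_of_mul_eq_one_right hab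
        exact (congrArg (· ∈ s) this).mpr hb
    rw [this]
    exact isClosedMap_fst_of_compactSpace _ ((isClosed_eq continuous_mul continuous_const).inter
      (hs.preimage continuous_snd))

end CHART

theorem mainTheorem2 (hCH : ContinuumHypothesis) {G : Type*} [Group G] [TopologicalSpace G]
    (hG : IsCHARTGroup G) (hseq : SeqCompactSpace G) :
    TopologicalSpace.MetrizableSpace G ∧ IsTopologicalGroup G := by
  have := hG.compactSpace
  have := hG.t2Space
  obtain ⟨p, F, hF, hp⟩ := hCH.exists_isPiNetworkAt (X := G)
  have hm : MetrizableSpace G := metrizableSpace_of_isGδ_diagonal (hG.isGδ_diagonal hF hp)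
  have : ContinuousMul G := ⟨hG.continuous_mul⟩
  exact ⟨hm, isTopologicalGroup_of_compactSpace_of_continuousMul⟩
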